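/- Let $G$ be a finite simple planar graph on $n\ge 2$ vertices that contains no cycle $C_7$ on $7$ vertices as a (not necessarily induced) subgraph. Suppose that every maximal $2$-connected subgraph (block) of $G$ has at most $7$ vertices, where a subgraph is called $2$-connected if it has at least two vertices, is connected, and remains connected after the deletion of any one of its vertices (so a single edge with its two ends is $2$-connected). Then the number $e(G)$ of edges of $G$ satisfies $$e(G)\le \frac52 n-\frac{18}{7}.$$ -/

import Mathlib

/-- A drawing of the graph `G` in the Euclidean plane without crossings: the vertices are distinct
points, each edge is a simple arc (an injective continuous image of `[0, 1]`) joining the points of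
its two end vertices, and the interior of an arc contains no vertex and no point of another arc. -/
structure PlaneDrawing {V : Type*} (G : SimpleGraph V) where
  /-- the position of a vertex -/
  point : V → EuclideanSpace ℝ (Fin 2)
  /-- a parametrization of the arc that represents an edge -/
  arc : G.edgeSet → C(unitInterval, EuclideanSpace ℝ (Fin 2))
  point_injective : Function.Injective point
  arc_injective : ∀ e, Function.Injective (arc e)
  arc_ends : ∀ e : G.edgeSet, s(arc e 0, arc e 1) = (e : Sym2 V).map point
  arc_ne_point : ∀ (e : G.edgeSet) (t : unitInterval), t ≠ 0 → t ≠ 1 →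
    ∀ v : V, arc e t ≠ point v
  arc_ne_arc : ∀ (e f : G.edgeSet), e ≠ f → ∀ (t : unitInterval), t ≠ 0 → t ≠ 1 →
    ∀ u : unitInterval, arc e t ≠ arc f u

/-- A graph is planar if it can be drawn in the plane without crossings. -/
def IsPlanar {V : Type*} (G : SimpleGraph V) : Prop :=
  Nonempty (PlaneDrawing G)

/-- A subgraph is 2-connected if it has at least two vertices, is connected, and stays connected
when any one of its vertices is deleted. A single edge with its two ends counts as 2-connected, so
that the maximal 2-connected subgraphs are the usual blocks. -/
def IsTwoConnected {V : Type*} {G : SimpleGraph V} (H : G.Subgraph) : Prop :=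
  H.verts.Nontrivial ∧ H.Connected ∧ ∀ v ∈ H.verts, (H.deleteVerts {v}).Connected

/-- A block of `G`: a subgraph that is maximal among the 2-connected subgraphs of `G`. -/
def IsBlock {V : Type*} {G : SimpleGraph V} (B : G.Subgraph) : Prop :=
  Maximal (fun H : G.Subgraph => IsTwoConnected H) B

/-! The stronger bound e ≤ 12/5 (n - 1) holds, and it suffices once n ≥ 12/7. The quantity n - 1 is
additive when two pieces share one vertex. Induction on vertex sets therefore removes vertices of
degree at most one and splits at missing connections and cut vertices, until a 2-connected set of
minimum degree two remains. Such a set lies in a block, so it has m ≤ 7 vertices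
(`adjPairCount_le_of_planar`).

For m ≤ 4 even complete graphs obey the bound. For m = 5, 6, 7 it allows 9, 12, 14 edges: excluding
K₅ gives the first, excluding K₃,₃ the second, and an Ore-Chvátal degree argument for graphs without
a spanning cycle or K₃,₃ the third.

Planarity enters only by excluding K₅ and K₃,₃. If two arcs γ, δ are disjoint, γ(s) - δ(t) never
vanishes on the unit square, so its argument has total change zero around the boundary. This gives a
linear equation between winding numbers of arcs around vertices. For either graph the equations
contradict each other modulo 2. -/

/-! ### Continuous logarithms and winding numbers -/

theorem exists_continuous_log {X : Type*} [TopologicalSpace X] [SimplyConnectedSpace X]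
    [LocallyPathConnectedSpace X] (g : X → ℂ) (hg : Continuous g) (h0 : ∀ x, g x ≠ 0) :
    ∃ L : X → ℂ, Continuous L ∧ ∀ x, Complex.exp (L x) = g x := by
  obtain ⟨x₀⟩ : Nonempty X := inferInstance
  obtain ⟨F, ⟨-, hF⟩, -⟩ := Complex.isCoveringMapOn_exp.existsUnique_continuousMap_lifts
    ⟨g, hg⟩ (a₀ := x₀) (Complex.exp_log (h0 x₀)) h0
  exact ⟨F, F.continuous, fun x => congrFun hF x⟩

/-- The increment of a continuous logarithm does not depend on the choice of the logarithm, nor on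
a constant factor of the function. -/
theorem log_increment_unique {L L' : ℝ → ℂ} (hL : Continuous L) (hL' : Continuous L') {z : ℂ}
    (h : ∀ x, Complex.exp (L' x) = z * Complex.exp (L x)) : L' 1 - L' 0 = L 1 - L 0 := by
  obtain ⟨F, -, hF⟩ := Complex.isCoveringMapOn_exp.existsUnique_continuousMap_lifts
    ⟨fun x => Complex.exp (L x), by fun_prop⟩ (a₀ := (0 : ℝ)) (e₀ := L 0) rfl
    (fun x => Complex.exp_ne_zero _)
  have h1 := hF ⟨L, hL⟩ ⟨rfl, rfl⟩
  have h2 := hF ⟨fun x => L' x + (L 0 - L' 0), by fun_prop⟩ ⟨by simp, by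
    funext x
    have hz : z ≠ 0 := by
      rintro rfl
      exact Complex.exp_ne_zero _ ((h 0).trans (zero_mul _))
    have e0 := Complex.exp_ne_zero (L 0)
    simp only [ContinuousMap.coe_mk, Function.comp, Complex.exp_add, Complex.exp_sub, h]
    field_simp⟩
  have h3 := DFunLike.congr_fun (h2.trans h1.symm) 1
  simp only [ContinuousMap.coe_mk] at h3
  linear_combination h3

/-- The sign that records the order of two elements. -/
def orderSign {ι : Type*} [LinearOrder ι] (a b : ι) : ℤ := if a < b then -1 else 1

open Complex in
/-- Winding numbers of arcs around points, for a family of curves in the plane of which any two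
with disjoint ends are disjoint, satisfy one linear equation for each such pair. -/
theorem exists_winding_numbers {ι : Type*} [LinearOrder ι] {E : ι → ι → Prop} {p : ι → ℂ}
    (hp : Function.Injective p) {γ : ι → ι → ℝ → ℂ} (hc : ∀ a b, E a b → Continuous (γ a b))
    (h0 : ∀ a b, E a b → γ a b 0 = p a) (h1 : ∀ a b, E a b → γ a b 1 = p b)
    (hv : ∀ a b v, E a b → v ≠ a → v ≠ b → ∀ t, γ a b t ≠ p v)
    (hd : ∀ a b c d, E a b → E c d → a ≠ c → a ≠ d → b ≠ c → b ≠ d →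
      ∀ s t, γ a b s ≠ γ c d t) :
    ∃ K : ι → ι → ι → ℤ, ∀ a b c d, E a b → E c d → a ≠ c → a ≠ d → b ≠ c → b ≠ d →
      orderSign c b + orderSign a c + orderSign b d + orderSign d a
        + 2 * (K c a b + K b c d - K d a b - K a c d) = 0 := by
  classical
  -- Logarithms of `p v - p u`, chosen so that swapping `u` and `v` changes them by exactly ±πi.
  let α : ι → ι → ℂ := fun u v =>
    if u < v then log (p v - p u) else log (p u - p v) + Real.pi * I
  have hα : ∀ u v, u ≠ v → exp (α u v) = p v - p u := by
    intro u v huv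
    have h : p u - p v ≠ 0 := sub_ne_zero.2 (hp.ne huv)
    have h' : p v - p u ≠ 0 := sub_ne_zero.2 (hp.ne huv.symm)
    simp only [α]
    split_ifs
    · rw [exp_log h']
    · rw [exp_add, exp_log h, exp_pi_mul_I]; ring
  have hαs : ∀ u v, u ≠ v → α u v - α v u = orderSign u v * (Real.pi * I) := by
    intro u v huv
    rcases lt_or_gt_of_ne huv with h | h
    · simp [α, orderSign, h, h.not_gt]
    · simp [α, orderSign, h, h.not_gt]
  -- The integer must serve every logarithm `L` and factor `z`: the same winding number occurs in
  -- several equations, for `γ a b t - p v` and for its negative.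
  have key : ∀ v a b, ∃ k : ℤ, E a b → v ≠ a → v ≠ b → ∀ L : ℝ → ℂ, Continuous L → ∀ z : ℂ,
      (∀ t, z * exp (L t) = γ a b t - p v) →
      L 1 - L 0 = α v b - α v a + k * (2 * Real.pi * I) := by
    intro v a b
    by_cases h : E a b ∧ v ≠ a ∧ v ≠ b
    · obtain ⟨hE, ha, hb⟩ := h
      have hcont := hc a b hE
      obtain ⟨L, hL, hLe⟩ := exists_continuous_log (fun t => γ a b t - p v) (by fun_prop)
        (fun t => sub_ne_zero.2 (hv a b v hE ha hb t))
      have : exp (L 1 - L 0) = exp (α v b - α v a) := by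
        rw [exp_sub, exp_sub, hLe, hLe, hα v b hb, hα v a ha, h0 a b hE, h1 a b hE]
      obtain ⟨k, hk⟩ := exp_eq_exp_iff_exists_int.1 this
      refine ⟨k, fun _ _ _ L' hL' z hz => ?_⟩
      rw [← hk]
      exact (log_increment_unique hL' hL fun x => by rw [hLe, hz]).symm
    · exact ⟨0, fun h1 h2 h3 => (h ⟨h1, h2, h3⟩).elim⟩
  choose K hK using key
  refine ⟨K, fun a b c d hab hcd hac had hbc hbd => ?_⟩
  have c1 := hc a b hab
  have c2 := hc c d hcd
  -- On the four sides of the unit square one of the curves rests at an end. The increments of the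
  -- single function `L` along these sides cancel around the boundary.
  obtain ⟨L, hL, hLe⟩ := exists_continuous_log (fun x : ℝ × ℝ => γ a b x.1 - γ c d x.2)
    (by fun_prop) (fun x => sub_ne_zero.2 (hd a b c d hab hcd hac had hbc hbd _ _))
  have e1 := hK c a b hab hac.symm hbc.symm (fun s => L (s, 0)) (by fun_prop) 1
    (fun t => by rw [hLe, h0 c d hcd, one_mul])
  have e2 := hK d a b hab had.symm hbd.symm (fun s => L (s, 1)) (by fun_prop) 1
    (fun t => by rw [hLe, h1 c d hcd, one_mul])
  have e3 := hK a c d hcd hac had (fun s => L (0, s)) (by fun_prop) (-1)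
    (fun t => by rw [hLe, h0 a b hab]; ring)
  have e4 := hK b c d hcd hbc hbd (fun s => L (1, s)) (by fun_prop) (-1)
    (fun t => by rw [hLe, h1 a b hab]; ring)
  have s1 := hαs c b hbc.symm
  have s2 := hαs a c hac
  have s3 := hαs b d hbd
  have s4 := hαs d a had.symm
  have hpi : (Real.pi * I : ℂ) ≠ 0 := mul_ne_zero (by exact_mod_cast Real.pi_ne_zero) I_ne_zero
  have : ((orderSign c b + orderSign a c + orderSign b d + orderSign d a
        + 2 * (K c a b + K b c d - K d a b - K a c d) : ℤ) : ℂ) = 0 := by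
    apply mul_right_cancel₀ hpi
    push_cast
    linear_combination -s1 - s2 - s3 - s4 - e1 + e2 + e3 - e4
  exact_mod_cast this

/-! ### Curves from a plane drawing -/

namespace PlaneDrawing

variable {V : Type*} {G : SimpleGraph V}

theorem exists_arc_end_eq (D : PlaneDrawing G) (e : G.edgeSet) {t : unitInterval} (h : t = 0 ∨ t = 1) :
    ∃ w ∈ (e : Sym2 V), D.arc e t = D.point w := by
  have h1 := D.arc_ends e
  have : D.arc e t ∈ (e : Sym2 V).map D.point := by
    rw [← h1]
    rcases h with rfl | rfl <;> simp
  obtain ⟨w, hw, he⟩ := Sym2.mem_map.1 this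
  exact ⟨w, hw, he.symm⟩

theorem mem_of_arc_eq_point (D : PlaneDrawing G) {e : G.edgeSet} {t : unitInterval} {v : V}
    (h : D.arc e t = D.point v) : v ∈ (e : Sym2 V) := by
  by_cases ht : t = 0 ∨ t = 1
  · obtain ⟨w, hw, he⟩ := D.exists_arc_end_eq e ht
    rwa [← D.point_injective (he.symm.trans h)]
  · push Not at ht
    exact (D.arc_ne_point e t ht.1 ht.2 v h).elim

theorem exists_common_end (D : PlaneDrawing G) {e f : G.edgeSet} (hef : e ≠ f) {t u : unitInterval}
    (h : D.arc e t = D.arc f u) : ∃ w, w ∈ (e : Sym2 V) ∧ w ∈ (f : Sym2 V) := by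
  by_cases ht : t = 0 ∨ t = 1
  · obtain ⟨w, hw, he⟩ := D.exists_arc_end_eq e ht
    exact ⟨w, hw, D.mem_of_arc_eq_point (h.symm.trans he)⟩
  · push Not at ht
    exact (D.arc_ne_arc e f hef t ht.1 ht.2 u h).elim

/-- `arc_ends` leaves the direction of an arc open, so the arc is reversed if necessary. It is then
extended to ℝ by constants. -/
theorem exists_curve (D : PlaneDrawing G) {u v : V} (h : G.Adj u v) :
    ∃ γ : ℝ → EuclideanSpace ℝ (Fin 2), Continuous γ ∧ γ 0 = D.point u ∧ γ 1 = D.point v ∧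
      ∀ t, ∃ s, γ t = D.arc ⟨s(u, v), h⟩ s := by
  let e : G.edgeSet := ⟨s(u, v), h⟩
  have h1 := D.arc_ends e
  simp only [e, Sym2.map_mk, Sym2.eq_iff] at h1
  rcases h1 with ⟨ha, hb⟩ | ⟨ha, hb⟩
  · refine ⟨fun t => D.arc e (Set.projIcc 0 1 zero_le_one t),
      (D.arc e).continuous.comp continuous_projIcc, ?_, ?_, fun t => ⟨_, rfl⟩⟩
    · simp only [Set.projIcc_left]; exact ha
    · simp only [Set.projIcc_right]; exact hb
  · refine ⟨fun t => D.arc e (Set.projIcc 0 1 zero_le_one (1 - t)),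
      (D.arc e).continuous.comp (continuous_projIcc.comp (by fun_prop)), ?_, ?_, fun t => ⟨_, rfl⟩⟩
    · simp only [sub_zero, Set.projIcc_right]; exact hb
    · simp only [sub_self, Set.projIcc_left]; exact ha

theorem exists_winding_numbers (D : PlaneDrawing G) {ι : Type*} [LinearOrder ι]
    {f : ι → V} (hf : Function.Injective f) :
    ∃ K : ι → ι → ι → ℤ, ∀ a b c d, G.Adj (f a) (f b) → G.Adj (f c) (f d) →
      a ≠ c → a ≠ d → b ≠ c → b ≠ d →
      orderSign c b + orderSign a c + orderSign b d + orderSign d a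
        + 2 * (K c a b + K b c d - K d a b - K a c d) = 0 := by
  have : ∀ a b, ∃ γ : ℝ → EuclideanSpace ℝ (Fin 2), ∀ h : G.Adj (f a) (f b),
      Continuous γ ∧ γ 0 = D.point (f a) ∧ γ 1 = D.point (f b) ∧
      ∀ t, ∃ s, γ t = D.arc ⟨s(f a, f b), h⟩ s := by
    intro a b
    by_cases h : G.Adj (f a) (f b)
    · obtain ⟨γ, hγ⟩ := D.exists_curve h
      exact ⟨γ, fun _ => hγ⟩
    · exact ⟨fun _ => 0, fun h' => (h h').elim⟩
  choose γ hγ using this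
  let φ := Complex.orthonormalBasisOneI.repr.symm
  refine _root_.exists_winding_numbers (E := fun a b => G.Adj (f a) (f b))
    (p := fun a => φ (D.point (f a))) (γ := fun a b t => φ (γ a b t))
    (φ.injective.comp (D.point_injective.comp hf)) ?_ ?_ ?_ ?_ ?_
  · intro a b h
    exact φ.continuous.comp (hγ a b h).1
  · intro a b h
    simp only [(hγ a b h).2.1]
  · intro a b h
    simp only [(hγ a b h).2.2.1]
  · intro a b v h ha hb t ht
    obtain ⟨s, hs⟩ := (hγ a b h).2.2.2 t
    have := D.mem_of_arc_eq_point (hs.symm.trans (φ.injective ht))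
    rcases Sym2.mem_iff.1 this with h | h
    · exact ha (hf h)
    · exact hb (hf h)
  · intro a b c d hab hcd hac had hbc hbd s t ht
    obtain ⟨s', hs⟩ := (hγ a b hab).2.2.2 s
    obtain ⟨t', ht'⟩ := (hγ c d hcd).2.2.2 t
    have hab' := hf.ne hac
    have had' := hf.ne had
    have hbc' := hf.ne hbc
    have hbd' := hf.ne hbd
    have hne : (⟨s(f a, f b), hab⟩ : G.edgeSet) ≠ ⟨s(f c, f d), hcd⟩ := by
      intro h
      have := Sym2.eq_iff.1 (congrArg Subtype.val h)
      tauto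
    obtain ⟨w, hw1, hw2⟩ := D.exists_common_end hne ((hs.symm.trans (φ.injective ht)).trans ht')
    simp only [Sym2.mem_iff] at hw1 hw2
    rcases hw1 with rfl | rfl <;> tauto

end PlaneDrawing

/-! ### Nonplanarity of K₅ and K₃,₃ -/

/-- After halving, the sign part of an equation is odd exactly when the two pairs interleave. In the
sum of all 15 equations each winding number occurs twice, while 5 pairs interleave, which is odd. -/
theorem IsPlanar.not_completeGraph_five {V : Type*} {G : SimpleGraph V}
    (h : IsPlanar G) {f : Fin 5 → V}
    (hf : Function.Injective f) : ¬ ∀ i j, i ≠ j → G.Adj (f i) (f j) := by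
  obtain ⟨D⟩ := h
  obtain ⟨K, hK⟩ := D.exists_winding_numbers hf
  intro hadj
  have key : ∀ a b c d, a ≠ b → c ≠ d → a ≠ c → a ≠ d → b ≠ c → b ≠ d → _ :=
    fun a b c d h1 h2 => hK a b c d (hadj a b h1) (hadj c d h2)
  clear hK hadj
  -- The order conditions select each unordered pair of disjoint edges once, with fixed
  -- orientations.
  have q : ∀ a b c d : Fin 5, a < b ∧ c < d ∧ a < c ∧ b ≠ c ∧ b ≠ d →
      orderSign c b + orderSign a c + orderSign b d + orderSign d a
        + 2 * (K c a b + K b c d - K d a b - K a c d) = 0 := fun a b c d h =>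
    key a b c d h.1.ne h.2.1.ne h.2.2.1.ne (h.2.2.1.trans h.2.1).ne h.2.2.2.1 h.2.2.2.2
  have a1 := q 0 1 2 3 (by decide)
  have a2 := q 0 2 1 3 (by decide)
  have a3 := q 0 3 1 2 (by decide)
  have b1 := q 0 1 2 4 (by decide)
  have b2 := q 0 2 1 4 (by decide)
  have b3 := q 0 4 1 2 (by decide)
  have c1 := q 0 1 3 4 (by decide)
  have c2 := q 0 3 1 4 (by decide)
  have c3 := q 0 4 1 3 (by decide)
  have d1 := q 0 2 3 4 (by decide)
  have d2 := q 0 3 2 4 (by decide)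
  have d3 := q 0 4 2 3 (by decide)
  have e1 := q 1 2 3 4 (by decide)
  have e2 := q 1 3 2 4 (by decide)
  have e3 := q 1 4 2 3 (by decide)
  clear q key
  simp [orderSign] at a1 a2 a3 b1 b2 b3 c1 c2 c3 d1 d2 d3 e1 e2 e3
  omega

/-- The same parity count: 18 pairs of disjoint edges, each winding number in two of the equations,
and 9 interleaving pairs. -/
theorem IsPlanar.not_completeBipartite_three_three {V : Type*} {G : SimpleGraph V}
    (h : IsPlanar G) {f : Fin 6 → V}
    (hf : Function.Injective f) : ¬ ∀ i j : Fin 6, i < 3 → 3 ≤ j → G.Adj (f i) (f j) := by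
  obtain ⟨D⟩ := h
  obtain ⟨K, hK⟩ := D.exists_winding_numbers hf
  intro hadj
  have q : ∀ a b c d : Fin 6, a < c ∧ c < 3 ∧ 3 ≤ b ∧ 3 ≤ d ∧ b ≠ d →
      orderSign c b + orderSign a c + orderSign b d + orderSign d a
        + 2 * (K c a b + K b c d - K d a b - K a c d) = 0 := fun a b c d h =>
    hK a b c d (hadj a b (h.1.trans h.2.1) h.2.2.1) (hadj c d h.2.1 h.2.2.2.1) h.1.ne
      ((h.1.trans h.2.1).trans_le h.2.2.2.1).ne (h.2.1.trans_le h.2.2.1).ne' h.2.2.2.2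
  clear hK hadj
  have a1 := q 0 3 1 4 (by decide)
  have a2 := q 0 3 1 5 (by decide)
  have a3 := q 0 4 1 3 (by decide)
  have a4 := q 0 4 1 5 (by decide)
  have a5 := q 0 5 1 3 (by decide)
  have a6 := q 0 5 1 4 (by decide)
  have b1 := q 0 3 2 4 (by decide)
  have b2 := q 0 3 2 5 (by decide)
  have b3 := q 0 4 2 3 (by decide)
  have b4 := q 0 4 2 5 (by decide)
  have b5 := q 0 5 2 3 (by decide)
  have b6 := q 0 5 2 4 (by decide)
  have c1 := q 1 3 2 4 (by decide)
  have c2 := q 1 3 2 5 (by decide)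
  have c3 := q 1 4 2 3 (by decide)
  have c4 := q 1 4 2 5 (by decide)
  have c5 := q 1 5 2 3 (by decide)
  have c6 := q 1 5 2 4 (by decide)
  clear q
  simp [orderSign] at a1 a2 a3 a4 a5 a6 b1 b2 b3 b4 b5 b6 c1 c2 c3 c4 c5 c6
  omega

open Finset in
theorem IsPlanar.not_complete_between {V : Type*} {G : SimpleGraph V} (h : IsPlanar G)
    {X Y : Finset V} (hX : 3 ≤ #X) (hY : 3 ≤ #Y) : ¬ ∀ x ∈ X, ∀ y ∈ Y, G.Adj x y := by
  intro hadj
  obtain ⟨g⟩ : Nonempty (Fin 3 ↪ X) := by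
    rw [Function.Embedding.nonempty_iff_card_le]; simpa using hX
  obtain ⟨k⟩ : Nonempty (Fin 3 ↪ Y) := by
    rw [Function.Embedding.nonempty_iff_card_le]; simpa using hY
  have hgk : ∀ i j, G.Adj (g i) (k j) := fun i j => hadj _ (g i).2 _ (k j).2
  refine h.not_completeBipartite_three_three
    (f := Fin.append (fun i => (g i : V)) (fun i => (k i : V))) ?_ ?_
  · rw [Fin.append_injective_iff]
    exact ⟨Subtype.val_injective.comp g.injective, Subtype.val_injective.comp k.injective,
      fun i j => (hgk i j).ne⟩
  · intro i j
    refine Fin.addCases (m := 3) (n := 3) (fun i => ?_) (fun i => ?_) i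
    · refine Fin.addCases (m := 3) (n := 3) (fun j => ?_) (fun j => ?_) j
      · intro _ h
        have := j.2
        simp [Fin.le_def] at h
        omega
      · intro _ _
        rw [Fin.append_left, Fin.append_right]
        exact hgk i j
    · intro h
      simp [Fin.lt_def] at h

/-! ### Seven vertices without a spanning cycle -/

/-- A graph has a cycle through seven vertices. -/
def HasSevenCycle {W : Type*} (H : SimpleGraph W) : Prop :=
  ∃ f : Fin 7 → W, Function.Injective f ∧ ∀ i, H.Adj (f i) (f (i + 1))

theorem HasSevenCycle.not_free {W : Type*} {H : SimpleGraph W} (h : HasSevenCycle H) :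
    ¬ (SimpleGraph.cycleGraph 7).Free H := by
  obtain ⟨f, hf, hadj⟩ := h
  refine not_not.2 ⟨⟨⟨f, fun {a b} hab => ?_⟩, hf⟩⟩
  rcases SimpleGraph.cycleGraph_adj.1 hab with h | h
  · have := hadj b
    rw [← h, add_sub_cancel] at this
    exact this.symm
  · have := hadj a
    rwa [← h, add_sub_cancel] at this

section SevenVertices

open Finset

variable {W : Type*}

/-- A spanning path of seven vertices whose ends have crossing edges to two consecutive vertices
can be rerouted to a cycle. -/
theorem hasSevenCycle_of_crossing {H : SimpleGraph W} {p : Fin 7 → W} (hp : Function.Injective p)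
    (hadj : ∀ j : Fin 6, H.Adj (p j.castSucc) (p j.succ)) (j : Fin 6)
    (h0 : H.Adj (p 0) (p j.succ)) (h6 : H.Adj (p 6) (p j.castSucc)) : HasSevenCycle H := by
  -- The cycle is 0, …, j, 6, 5, …, j + 1; subtraction modulo 7 yields the descending part.
  let σ : Fin 6 → Fin 7 → Fin 7 := fun j i => if i ≤ j.castSucc then i else j.castSucc - i
  have hσ : ∀ j, Function.Injective (σ j) := by decide
  have hσ' : ∀ j i, (∃ l : Fin 6, σ j i = l.castSucc ∧ σ j (i + 1) = l.succ) ∨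
      (∃ l : Fin 6, σ j i = l.succ ∧ σ j (i + 1) = l.castSucc) ∨
      (σ j i = j.castSucc ∧ σ j (i + 1) = 6) ∨ (σ j i = j.succ ∧ σ j (i + 1) = 0) := by decide
  refine ⟨fun i => p (σ j i), hp.comp (hσ j), fun i => ?_⟩
  rcases hσ' j i with ⟨l, h1, h2⟩ | ⟨l, h1, h2⟩ | ⟨h1, h2⟩ | ⟨h1, h2⟩ <;> simp only [h1, h2]
  · exact hadj l
  · exact (hadj l).symm
  · exact h6.symm
  · exact h0.symm

theorem exists_spanning_path {H : SimpleGraph W} (hH : ¬ HasSevenCycle H) {u v : W}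
    (h : HasSevenCycle (H ⊔ SimpleGraph.edge u v)) :
    ∃ p : Fin 7 → W, Function.Injective p ∧ (∀ j : Fin 6, H.Adj (p j.castSucc) (p j.succ)) ∧
      s(p 0, p 6) = s(u, v) := by
  obtain ⟨f, hf, hadj⟩ := h
  obtain ⟨i, hi⟩ : ∃ i, ¬ H.Adj (f i) (f (i + 1)) := by
    by_contra! hcon
    exact hH ⟨f, hf, hcon⟩
  have key : ∀ j, H.Adj (f j) (f (j + 1)) ∨ s(f j, f (j + 1)) = s(u, v) := by
    intro j
    rcases hadj j with h | h
    · exact Or.inl h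
    · rw [SimpleGraph.edge_adj] at h
      exact Or.inr (Sym2.eq_iff.2 h.1)
  have hi' := (key i).resolve_left hi
  -- The cycle uses the new edge at position `i`, and only there; cutting it there leaves the path.
  refine ⟨fun j => f (i + 1 + j), fun a b h => add_left_cancel (hf h), fun j => ?_, ?_⟩
  · have e : i + 1 + j.succ = (i + 1 + j.castSucc) + 1 := by
      rw [add_assoc _ _ 1, Fin.coeSucc_eq_succ]
    simp only [e]
    refine (key (i + 1 + j.castSucc)).resolve_right fun h => ?_
    rw [← hi', Sym2.eq_iff] at h
    simp only [hf.eq_iff] at h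
    clear e hi' hi key hadj hf
    revert i j
    decide
  · have e : i + 1 + 6 = i := by clear hi hi'; revert i; decide
    simp only [e, add_zero]
    rw [Sym2.eq_swap, hi']

variable [Fintype W]

theorem card_nonneighbors (hW : Fintype.card W = 7) (H : SimpleGraph W) [DecidableRel H.Adj]
    (u : W) : #{w | ¬ H.Adj u w} + H.degree u = 7 := by
  rw [← hW, ← SimpleGraph.card_neighborFinset_eq_degree, SimpleGraph.neighborFinset_eq_filter,
    add_comm, card_filter_add_card_filter_not]
  rfl

theorem degree_le_six (hW : Fintype.card W = 7) (H : SimpleGraph W) [DecidableRel H.Adj]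
    (u : W) : H.degree u ≤ 6 := by
  have := H.degree_lt_card_verts u
  omega

variable [DecidableEq W]

/-- Ore's argument: along a spanning path, the predecessors of neighbors of the first vertex and the
neighbors of the last vertex are disjoint sets among six positions. -/
theorem degree_add_degree_le_six (hW : Fintype.card W = 7) {H : SimpleGraph W}
    [DecidableRel H.Adj] (hH : ¬ HasSevenCycle H) {u v : W}
    (huv : ¬ H.Adj u v) (h : HasSevenCycle (H ⊔ SimpleGraph.edge u v)) :
    H.degree u + H.degree v ≤ 6 := by
  obtain ⟨p, hp, hadj, hend⟩ := exists_spanning_path hH h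
  have hsum : H.degree (p 0) + H.degree (p 6) = H.degree u + H.degree v := by
    rcases Sym2.eq_iff.1 hend with ⟨h1, h2⟩ | ⟨h1, h2⟩
    · rw [h1, h2]
    · rw [h1, h2, add_comm]
  have hnadj : ¬ H.Adj (p 0) (p 6) := by
    rcases Sym2.eq_iff.1 hend with ⟨h1, h2⟩ | ⟨h1, h2⟩
    · rwa [h1, h2]
    · rwa [h1, h2, SimpleGraph.adj_comm]
  have hbij : Function.Bijective p :=
    (Fintype.bijective_iff_injective_and_card p).2 ⟨hp, by simp [hW]⟩
  rw [← hsum]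
  have h0 : H.degree (p 0) ≤ #{j : Fin 6 | H.Adj (p 0) (p j.succ)} := by
    rw [← SimpleGraph.card_neighborFinset_eq_degree]
    refine (card_le_card (t := image (fun j : Fin 6 => p j.succ) _) fun w hw => ?_).trans
      card_image_le
    rw [SimpleGraph.mem_neighborFinset] at hw
    obtain ⟨j, rfl⟩ := hbij.2 w
    obtain ⟨l, rfl⟩ := Fin.exists_succ_eq.2 (fun h0 : j = 0 => hw.ne (by rw [h0]))
    exact mem_image.2 ⟨l, by simpa using hw, rfl⟩
  have h6 : H.degree (p 6) ≤ #{j : Fin 6 | H.Adj (p 6) (p j.castSucc)} := by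
    rw [← SimpleGraph.card_neighborFinset_eq_degree]
    refine (card_le_card (t := image (fun j : Fin 6 => p j.castSucc) _) fun w hw => ?_).trans
      card_image_le
    rw [SimpleGraph.mem_neighborFinset] at hw
    obtain ⟨j, rfl⟩ := hbij.2 w
    obtain ⟨l, rfl⟩ := Fin.exists_castSucc_eq.2 (fun h0 : j = Fin.last 6 => hw.ne (by rw [h0]; rfl))
    exact mem_image.2 ⟨l, by simpa using hw, rfl⟩
  refine (add_le_add h0 h6).trans ?_
  rw [← card_union_of_disjoint]
  · exact (card_le_univ _).trans (by simp)
  · rw [disjoint_filter]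
    exact fun j _ hj hj' => hH (hasSevenCycle_of_crossing hp hadj j hj hj')

/-- A degree condition of Chvátal type on seven vertices. -/
theorem sum_degree_le_of_maximal_pair (hW : Fintype.card W = 7) {H : SimpleGraph W}
    [DecidableRel H.Adj] (hmin : ∀ w, 2 ≤ H.degree w) {u v : W}
    (hle : H.degree u ≤ H.degree v) (hsum : H.degree u + H.degree v ≤ 6)
    (hmax : ∀ x y, x ≠ y → ¬ H.Adj x y → H.degree x + H.degree y ≤ H.degree u + H.degree v) :
    ∑ w, H.degree w ≤ 28 ∨ (∑ w, H.degree w ≤ 30 ∧ (∑ w, H.degree w = 30 →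
      ∃ X Y : Finset W, 3 ≤ #X ∧ 3 ≤ #Y ∧ ∀ x ∈ X, ∀ y ∈ Y, H.Adj x y)) := by
  have hd6 := degree_le_six hW H
  have hu := card_nonneighbors hW H u
  have hv := card_nonneighbors hW H v
  have hB : ∀ w, ¬ H.Adj u w → H.degree w ≤ H.degree v := by
    intro w hw
    by_cases h : u = w
    · rwa [← h]
    · have := hmax u w h hw
      omega
  have hA : ∀ w, v ≠ w → ¬ H.Adj v w → H.degree w ≤ H.degree u := by
    intro w h hw
    have := hmax v w h hw
    omega
  have hu2 := hmin u
  obtain h2 | h3 : H.degree u = 2 ∨ H.degree u = 3 := by omega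
  · left
    -- Here `v` has degree at most 4. Of the maximum 7 · 6 = 42, the five non-neighbors of `u` (with
    -- `u` itself) lose 2 each, and at least two non-neighbors of `v` lose 2 more: 42 - 10 - 4 = 28.
    have hpt : ∀ w, H.degree w + (if w ≠ v ∧ ¬ H.Adj v w then 2 else 0)
        + (if ¬ H.Adj u w then 2 else 0) ≤ 6 := by
      intro w
      have h1 := hd6 w
      have h2 := hA w
      have h3 := hB w
      split_ifs with ha hb hb
      · have := h2 ha.1.symm ha.2
        omega
      · have := h2 ha.1.symm ha.2
        omega
      · omega
      · have := h3 hb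
        omega
    have := sum_le_sum fun w (_ : w ∈ univ) => hpt w
    simp only [sum_add_distrib, ← sum_filter, sum_const, card_univ, hW, smul_eq_mul] at this
    have hA' : #{w | w ≠ v ∧ ¬ H.Adj v w} + 1 = #{w | ¬ H.Adj v w} := by
      rw [← card_erase_add_one (s := {w | ¬ H.Adj v w}) (a := v) (by simp)]
      congr 2
      ext w
      simp
    omega
  · right
    -- Both degrees are 3, so four vertices lose 3 each: 42 - 12 = 30. Equality forces the three
    -- neighbors of `u` to be adjacent to everything, which gives K₃,₄.
    have hpt : ∀ w, H.degree w + (if ¬ H.Adj u w then 3 else 0) ≤ 6 := by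
      intro w
      have h1 := hd6 w
      have h3 := hB w
      split_ifs with hb
      · omega
      · have := h3 hb
        omega
    have hs := sum_le_sum fun w (_ : w ∈ univ) => hpt w
    have hc : ∑ w, (if ¬ H.Adj u w then 3 else 0) = 12 := by
      rw [← sum_filter, sum_const, smul_eq_mul]
      omega
    refine ⟨?_, fun heq => ⟨H.neighborFinset u, ({w | ¬ H.Adj u w} : Finset W), ?_, ?_, ?_⟩⟩
    · simp only [sum_add_distrib, sum_const, card_univ, hW, smul_eq_mul] at hs
      omega
    · rw [SimpleGraph.card_neighborFinset_eq_degree, h3]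
    · omega
    · intro x hx y hy
      rw [SimpleGraph.mem_neighborFinset] at hx
      simp only [mem_filter, mem_univ, true_and] at hy
      have hxd : H.degree x = 6 := by
        have := (sum_eq_sum_iff_of_le fun w (_ : w ∈ univ) => hpt w).1 (by
          rw [sum_add_distrib, hc, heq]; simp [hW]) x (mem_univ x)
        simpa [hx] using this
      have hsub : H.neighborFinset x ⊆ univ.erase x := by
        intro z hz
        rw [SimpleGraph.mem_neighborFinset] at hz
        simp [hz.ne']
      have := eq_of_subset_of_card_le hsub (by
        rw [card_erase_of_mem (mem_univ x), card_univ, hW,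
          SimpleGraph.card_neighborFinset_eq_degree, hxd])
      rw [← SimpleGraph.mem_neighborFinset, this]
      exact mem_erase.2 ⟨fun h => hy (h ▸ hx), mem_univ _⟩

/-- A graph on seven vertices with minimum degree two, without spanning cycle and without complete
bipartite subgraph on `3 + 3` vertices has at most 14 edges. -/
theorem sum_degree_le_of_not_hasSevenCycle (hW : Fintype.card W = 7) {H : SimpleGraph W}
    [DecidableRel H.Adj] (hmin : ∀ w, 2 ≤ H.degree w) (hH : ¬ HasSevenCycle H)
    (hK : ∀ X Y : Finset W, 3 ≤ #X → 3 ≤ #Y → ¬ ∀ x ∈ X, ∀ y ∈ Y, H.Adj x y) :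
    ∑ w, H.degree w ≤ 28 := by
  classical
  -- In an edge-maximal `M`, any added edge closes a spanning cycle, so Ore's bound holds for all
  -- nonadjacent pairs.
  obtain ⟨M, hHM, hM⟩ := (Set.toFinite {M : SimpleGraph W | ¬ HasSevenCycle M}).exists_le_maximal hH
  have hMc : ¬ HasSevenCycle M := hM.prop
  have hmono : ∀ w, H.degree w ≤ M.degree w := fun w => SimpleGraph.degree_le_of_le hHM
  have hmin' : ∀ w, 2 ≤ M.degree w := fun w => (hmin w).trans (hmono w)
  have hore : ∀ u v, u ≠ v → ¬ M.Adj u v → M.degree u + M.degree v ≤ 6 := by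
    intro u v huv hn
    refine degree_add_degree_le_six hW hMc hn ?_
    by_contra hcon
    have := hM.le_of_ge hcon le_sup_left
    exact hn (this (Or.inr (by simp [SimpleGraph.edge_adj, huv])))
  have hne : ({q : W × W | q.1 ≠ q.2 ∧ ¬ M.Adj q.1 q.2} : Finset (W × W)).Nonempty := by
    by_contra hcon
    rw [not_nonempty_iff_eq_empty] at hcon
    let e := (Fintype.equivFinOfCardEq hW).symm
    refine hMc ⟨e, e.injective, fun i => ?_⟩
    by_contra hi
    have : (e i, e (i + 1)) ∈ ({q : W × W | q.1 ≠ q.2 ∧ ¬ M.Adj q.1 q.2} : Finset (W × W)) := by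
      simp [hi]
    simp [hcon] at this
  obtain ⟨⟨u, v⟩, hq, hmax⟩ := exists_max_image _ (fun q : W × W => M.degree q.1 + M.degree q.2) hne
  simp only [mem_filter, mem_univ, true_and, Prod.forall, and_imp] at hq hmax
  have hB : ∑ w, M.degree w ≤ 28 ∨ (∑ w, M.degree w ≤ 30 ∧ (∑ w, M.degree w = 30 →
      ∃ X Y : Finset W, 3 ≤ #X ∧ 3 ≤ #Y ∧ ∀ x ∈ X, ∀ y ∈ Y, M.Adj x y)) := by
    rcases le_total (M.degree u) (M.degree v) with h | h
    · exact sum_degree_le_of_maximal_pair hW hmin' h (hore u v hq.1 hq.2) hmax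
    · have hq2 : ¬ M.Adj v u := fun h => hq.2 h.symm
      exact sum_degree_le_of_maximal_pair hW hmin' h (hore v u hq.1.symm hq2)
        fun x y hx hy => (hmax x y hx hy).trans_eq (add_comm _ _)
  have hsum : ∑ w, H.degree w ≤ ∑ w, M.degree w := sum_le_sum fun w _ => hmono w
  have hH2 := H.sum_degrees_eq_twice_card_edges
  have hM2 := M.sum_degrees_eq_twice_card_edges
  by_contra hcon
  obtain ⟨h30, hXY⟩ := hB.resolve_left (by omega)
  obtain ⟨X, Y, hX, hY, hadj⟩ := hXY (by omega)
  -- `M` need not inherit `hK`. But degree sums are even, so a sum above 28 in `H` is already the 30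
  -- of `M`.
  have heq : H = M := by
    rw [← SimpleGraph.edgeFinset_inj]
    exact eq_of_subset_of_card_le (SimpleGraph.edgeFinset_mono hHM) (by omega)
  subst heq
  exact hK X Y hX hY hadj

end SevenVertices

/-! ### Five and six vertices -/

section SmallGraphs

open Finset

variable {W : Type*} [Fintype W]

theorem sum_degree_le_mul_pred (H : SimpleGraph W) [DecidableRel H.Adj] :
    ∑ w, H.degree w ≤ Fintype.card W * (Fintype.card W - 1) := by
  refine (sum_le_card_nsmul _ _ _ fun w _ => Nat.le_pred_of_lt (H.degree_lt_card_verts w)).trans ?_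
  simp

theorem sum_degree_add_sum_degree_compl [DecidableEq W] (H : SimpleGraph W) [DecidableRel H.Adj] :
    ∑ w, H.degree w + ∑ w, Hᶜ.degree w = Fintype.card W * (Fintype.card W - 1) := by
  rw [← sum_add_distrib]
  have : ∀ w, H.degree w + Hᶜ.degree w = Fintype.card W - 1 := by
    intro w
    have := H.degree_lt_card_verts w
    rw [SimpleGraph.degree_compl]
    omega
  simp [this]

theorem sum_degree_le_of_card_eq_five [DecidableEq W] (hW : Fintype.card W = 5) {H : SimpleGraph W}
    [DecidableRel H.Adj]
    (hK : ∀ f : Fin 5 → W, Function.Injective f → ¬ ∀ i j, i ≠ j → H.Adj (f i) (f j)) :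
    ∑ w, H.degree w ≤ 18 := by
  have h1 := sum_degree_add_sum_degree_compl H
  have h2 := Hᶜ.sum_degrees_eq_twice_card_edges
  by_contra hcon
  have h3 : #Hᶜ.edgeFinset = 0 := by
    rw [hW] at h1
    omega
  rw [card_eq_zero, SimpleGraph.edgeFinset_eq_empty, compl_eq_bot] at h3
  let e := (Fintype.equivFinOfCardEq hW).symm
  refine hK e e.injective fun i j hij => ?_
  rw [h3]
  exact e.injective.ne hij

theorem exists_pair_superset {α : Type*} [Nonempty α] [DecidableEq α] {s : Finset α}
    (hs : #s ≤ 2) : ∃ a b, s ⊆ {a, b} := by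
  obtain ⟨x⟩ := ‹Nonempty α›
  obtain h | h | h : #s = 0 ∨ #s = 1 ∨ #s = 2 := by omega
  · exact ⟨x, x, by simp [card_eq_zero.1 h]⟩
  · obtain ⟨a, rfl⟩ := card_eq_one.1 h
    exact ⟨a, a, by simp⟩
  · obtain ⟨a, b, -, rfl⟩ := card_eq_two.1 h
    exact ⟨a, b, subset_rfl⟩

/-- Disjoint pairs go to opposite sides; overlapping pairs span at most three vertices and fit in
one side. -/
theorem exists_balanced_cut [DecidableEq W] (hW : Fintype.card W = 6) (a b c d : W) :
    ∃ X : Finset W, #X = 3 ∧ (a ∈ X ↔ b ∈ X) ∧ (c ∈ X ↔ d ∈ X) := by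
  by_cases h : Disjoint ({a, b} : Finset W) {c, d}
  · obtain ⟨X, h1, h2, h3⟩ := exists_subsuperset_card_eq (s := {a, b})
      (t := ({c, d} : Finset W)ᶜ) (n := 3) (le_compl_iff_disjoint_right.2 h)
      (card_le_two.trans (by norm_num)) (by
        have := card_le_two (a := c) (b := d)
        rw [card_compl, hW]
        omega)
    simp only [insert_subset_iff, singleton_subset_iff] at h1
    have hc : c ∉ X := fun h => by simpa using h2 h
    have hd : d ∉ X := fun h => by simpa using h2 h
    exact ⟨X, h3, by simp [h1], by simp [hc, hd]⟩
  · have hcard : #({a, b} ∪ {c, d} : Finset W) ≤ 3 := by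
      have h1 := card_union_add_card_inter ({a, b} : Finset W) {c, d}
      have h2 := card_le_two (a := a) (b := b)
      have h3 := card_le_two (a := c) (b := d)
      have h4 : 0 < #({a, b} ∩ {c, d} : Finset W) := by
        rw [card_pos, ← not_disjoint_iff_nonempty_inter]
        exact h
      omega
    obtain ⟨X, h1, -, h3⟩ := exists_subsuperset_card_eq (subset_univ ({a, b} ∪ {c, d} : Finset W))
      hcard (by rw [card_univ, hW]; norm_num)
    simp only [union_subset_iff, insert_subset_iff, singleton_subset_iff] at h1
    exact ⟨X, h3, by simp [h1], by simp [h1]⟩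

/-- With more than 12 edges at most two are missing, and a balanced cut that separates neither
missing pair is a K₃,₃. -/
theorem sum_degree_le_of_card_eq_six [DecidableEq W] (hW : Fintype.card W = 6) {H : SimpleGraph W}
    [DecidableRel H.Adj]
    (hK : ∀ X Y : Finset W, 3 ≤ #X → 3 ≤ #Y → ¬ ∀ x ∈ X, ∀ y ∈ Y, H.Adj x y) :
    ∑ w, H.degree w ≤ 24 := by
  have h1 := sum_degree_add_sum_degree_compl H
  have h2 := Hᶜ.sum_degrees_eq_twice_card_edges
  by_contra hcon
  rw [hW] at h1
  have : Nonempty W := Fintype.card_pos_iff.1 (by omega)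
  have : Nonempty (Sym2 W) := this.map Sym2.diag
  obtain ⟨e₁, e₂, he⟩ := exists_pair_superset (s := Hᶜ.edgeFinset) (by omega)
  induction e₁ with | _ a b
  induction e₂ with | _ c d
  obtain ⟨X, hX, hab, hcd⟩ := exists_balanced_cut hW a b c d
  refine hK X Xᶜ hX.ge (by rw [card_compl, hX, hW]) fun x hx y hy => ?_
  rw [mem_compl] at hy
  by_contra hxy
  have hmem : s(x, y) ∈ Hᶜ.edgeFinset := by
    rw [SimpleGraph.mem_edgeFinset, SimpleGraph.mem_edgeSet, SimpleGraph.compl_adj]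
    exact ⟨fun h => hy (h ▸ hx), hxy⟩
  have := he hmem
  simp only [mem_insert, mem_singleton, Sym2.eq_iff] at this
  rcases this with (⟨rfl, rfl⟩ | ⟨rfl, rfl⟩) | (⟨rfl, rfl⟩ | ⟨rfl, rfl⟩) <;> tauto

end SmallGraphs

/-! ### Reduction to 2-connected vertex sets -/

namespace SimpleGraph

open Finset

variable {V : Type*} (G : SimpleGraph V)

open Classical in
/-- The number of ordered pairs of adjacent vertices in `T`. -/
noncomputable def adjPairCount (T : Finset V) : ℕ := #{q ∈ T ×ˢ T | G.Adj q.1 q.2}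

open Classical in
theorem sum_degree_induce (T : Finset V) :
    ∑ w : (T : Set V), (G.induce (T : Set V)).degree w = G.adjPairCount T := by
  have h : ∀ w : (T : Set V), (G.induce (T : Set V)).degree w = #{x ∈ T | G.Adj w x} := by
    intro w
    rw [← card_neighborFinset_eq_degree, ← card_map (Function.Embedding.subtype _)]
    congr 1
    ext x
    simp only [mem_map, mem_neighborFinset, comap_adj, Function.Embedding.subtype_apply,
      Subtype.exists, mem_filter]
    constructor
    · rintro ⟨y, hy, h, rfl⟩
      exact ⟨hy, h⟩
    · rintro ⟨hx, h⟩
      exact ⟨x, hx, h, rfl⟩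
  simp only [h, adjPairCount, card_filter, sum_product]
  exact sum_coe_sort T fun v => ∑ x ∈ T, if G.Adj v x then 1 else 0

variable {G}

theorem adjPairCount_le_add {T A B : Finset V}
    (h : ∀ x ∈ T, ∀ y ∈ T, G.Adj x y → (x ∈ A ∧ y ∈ A) ∨ (x ∈ B ∧ y ∈ B)) :
    G.adjPairCount T ≤ G.adjPairCount A + G.adjPairCount B := by
  classical
  unfold adjPairCount
  refine (card_le_card fun q hq => ?_).trans (card_union_le _ _)
  simp only [mem_filter, mem_product, mem_union] at hq ⊢
  have := h _ hq.1.1 _ hq.1.2 hq.2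
  tauto

open Classical in
theorem adjPairCount_le_erase {T : Finset V} {x : V} (hx : #{y ∈ T | G.Adj x y} ≤ 1) :
    G.adjPairCount T ≤ G.adjPairCount (T.erase x) + 2 := by
  unfold adjPairCount
  have hsub : {q ∈ T ×ˢ T | G.Adj q.1 q.2} ⊆ {q ∈ T.erase x ×ˢ T.erase x | G.Adj q.1 q.2} ∪
      (image (fun y => (x, y)) {y ∈ T | G.Adj x y} ∪
        image (fun y => (y, x)) {y ∈ T | G.Adj x y}) := by
    rintro ⟨a, b⟩ hq
    simp only [mem_filter, mem_product, mem_union, mem_image, mem_erase, Prod.mk.injEq] at hq ⊢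
    by_cases ha : a = x
    · subst ha
      exact Or.inr (Or.inl ⟨b, ⟨hq.1.2, hq.2⟩, rfl, rfl⟩)
    · by_cases hb : b = x
      · subst hb
        exact Or.inr (Or.inr ⟨a, ⟨hq.1.1, hq.2.symm⟩, rfl, rfl⟩)
      · tauto
  refine (card_le_card hsub).trans ((card_union_le _ _).trans (Nat.add_le_add_left ?_ _))
  refine (card_union_le _ _).trans ?_
  exact add_le_add (card_image_le.trans hx) (card_image_le.trans hx)

/-- A vertex set that does not induce a connected subgraph splits into two nonempty parts without
edges between them. -/
theorem exists_separation {T : Finset V} (hT : T.Nonempty)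
    (h : ¬ ((⊤ : G.Subgraph).induce (T : Set V)).Connected) :
    ∃ A B : Finset V, A.Nonempty ∧ B.Nonempty ∧ #A + #B = #T ∧
      (∀ x, x ∈ T ↔ x ∈ A ∨ x ∈ B) ∧ ∀ x ∈ A, ∀ y ∈ B, ¬ G.Adj x y := by
  classical
  rw [← connected_induce_iff] at h
  have hne : Nonempty (T : Set V) := hT.to_subtype
  have hp : ¬ (G.induce (T : Set V)).Preconnected := fun hp => h ⟨hp⟩
  unfold Preconnected at hp
  push Not at hp
  obtain ⟨u, v, huv⟩ := hp
  let P : V → Prop := fun x => ∃ hx : x ∈ (T : Set V), (G.induce (T : Set V)).Reachable u ⟨x, hx⟩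
  refine ⟨{x ∈ T | P x}, {x ∈ T | ¬ P x}, ⟨u, ?_⟩, ⟨v, ?_⟩,
    card_filter_add_card_filter_not _, fun x => ?_, fun x hx y hy hxy => ?_⟩
  · exact mem_filter.2 ⟨u.2, u.2, Reachable.refl _⟩
  · exact mem_filter.2 ⟨v.2, fun ⟨_, h⟩ => huv h⟩
  · simp only [mem_filter]
    tauto
  · obtain ⟨-, hxT, hr⟩ := mem_filter.1 hx
    obtain ⟨hyT, hn⟩ := mem_filter.1 hy
    exact hn ⟨hyT, hr.trans (Adj.reachable (G := G.induce (T : Set V)) (u := ⟨x, hxT⟩)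
      (v := ⟨y, hyT⟩) hxy)⟩

theorem deleteVerts_induce_top [DecidableEq V] (T : Finset V) (v : V) :
    ((⊤ : G.Subgraph).induce (T : Set V)).deleteVerts {v}
      = (⊤ : G.Subgraph).induce ((T.erase v : Finset V) : Set V) := by
  ext x y
  · simp [and_comm]
  · simp only [Subgraph.induce_verts, Subgraph.induce_adj,
      Subgraph.top_adj, coe_erase, Set.mem_sdiff, Set.mem_singleton_iff]
    tauto

open Classical in
/-- The edge bound for planar graphs on at most seven vertices without spanning 7-cycle. -/
theorem adjPairCount_le_of_card_le_seven (hplanar : IsPlanar G) (hC7 : (cycleGraph 7).Free G)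
    {T : Finset V} (h2 : 2 ≤ #T) (h7 : #T ≤ 7) (hmin : ∀ x ∈ T, 2 ≤ #{y ∈ T | G.Adj x y}) :
    5 * G.adjPairCount T + 24 ≤ 24 * #T := by
  have hcard : Fintype.card (T : Set V) = #T := by simp
  have hinj := Subtype.val_injective (p := (· ∈ (T : Set V)))
  rw [← sum_degree_induce]
  have hle := sum_degree_le_mul_pred (G.induce (T : Set V))
  have hK : ∀ X Y : Finset (T : Set V), 3 ≤ #X → 3 ≤ #Y →
      ¬ ∀ x ∈ X, ∀ y ∈ Y, (G.induce (T : Set V)).Adj x y := by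
    intro X Y hX hY h
    refine hplanar.not_complete_between (X := X.map ⟨_, hinj⟩) (Y := Y.map ⟨_, hinj⟩)
      (by rwa [card_map]) (by rwa [card_map]) fun x hx y hy => ?_
    obtain ⟨x', hx', rfl⟩ := mem_map.1 hx
    obtain ⟨y', hy', rfl⟩ := mem_map.1 hy
    exact h x' hx' y' hy'
  obtain h | h | h | h : #T ≤ 4 ∨ #T = 5 ∨ #T = 6 ∨ #T = 7 := by omega
  -- For m ≤ 4 the trivial bound suffices: 5m(m - 1) ≤ 24(m - 1).
  · rw [hcard] at hle
    generalize ∑ w : (T : Set V), (G.induce (T : Set V)).degree w = D at *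
    generalize #T = m at *
    interval_cases m <;> omega
  · have := sum_degree_le_of_card_eq_five (hcard.trans h) (H := G.induce (T : Set V))
      fun f hf hadj => hplanar.not_completeGraph_five (hinj.comp hf) hadj
    omega
  · have := sum_degree_le_of_card_eq_six (hcard.trans h) hK
    omega
  · have := sum_degree_le_of_not_hasSevenCycle (hcard.trans h) (H := G.induce (T : Set V))
      (fun w => ?_) (fun ⟨f, hf, hadj⟩ => HasSevenCycle.not_free ⟨_, hinj.comp hf, hadj⟩ hC7) hK
    · omega
    · refine (hmin w w.2).trans ?_
      rw [← card_neighborFinset_eq_degree, ← card_map (Function.Embedding.subtype _)]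
      refine card_le_card fun x hx => ?_
      obtain ⟨hxT, hx⟩ := mem_filter.1 hx
      exact mem_map.2 ⟨⟨x, hxT⟩, by simpa using hx, rfl⟩

/-- If each 2-connected induced subgraph has at most seven vertices, then a planar graph without
7-cycles has at most `12 / 5 * (n - 1)` edges on each set of `n` vertices. -/
theorem adjPairCount_le_of_planar (hplanar : IsPlanar G) (hC7 : (cycleGraph 7).Free G)
    (hsmall : ∀ T : Finset V, IsTwoConnected ((⊤ : G.Subgraph).induce (T : Set V)) → #T ≤ 7)
    (T : Finset V) : T.Nonempty → 5 * G.adjPairCount T + 24 ≤ 24 * #T := by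
  classical
  induction T using Finset.strongInduction with | _ T ih
  intro hT
  have hlt : ∀ {A : Finset V}, (∀ x ∈ A, x ∈ T) → #A < #T → A.Nonempty →
      5 * G.adjPairCount A + 24 ≤ 24 * #A := fun hA hc hne =>
    ih _ (ssubset_of_subset_of_ne hA fun h => hc.ne (by rw [h])) hne
  obtain h1 | h2 : #T = 1 ∨ 2 ≤ #T := by
    have := hT.card_pos
    omega
  · obtain ⟨x, rfl⟩ := card_eq_one.1 h1
    have : G.adjPairCount {x} = 0 := by simp [adjPairCount]
    simp [this]
  -- Removing a vertex of degree at most one lowers the left side by at most 10 and the right side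
  -- by 24.
  by_cases hmin : ∀ x ∈ T, 2 ≤ #{y ∈ T | G.Adj x y}
  swap
  · push Not at hmin
    obtain ⟨x, hx, hdeg⟩ := hmin
    have hle := adjPairCount_le_erase (Nat.le_of_lt_succ hdeg)
    have hc := card_erase_add_one hx
    have := hlt (A := T.erase x) (fun _ => mem_of_mem_erase) (by omega)
      (card_pos.1 (by omega))
    omega
  by_cases hconn : ((⊤ : G.Subgraph).induce (T : Set V)).Connected
  swap
  · obtain ⟨A, B, hA, hB, hcard, hmem, hsep⟩ := exists_separation hT hconn
    have hle : G.adjPairCount T ≤ G.adjPairCount A + G.adjPairCount B := by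
      refine adjPairCount_le_add fun x hx y hy hxy => ?_
      have h1 := hsep x
      have h2 := fun h h' => hsep y h x h' hxy.symm
      have h3 := (hmem x).1 hx
      have h4 := (hmem y).1 hy
      tauto
    have hA0 := hA.card_pos
    have hB0 := hB.card_pos
    have h1 := hlt (fun x hx => (hmem x).2 (Or.inl hx)) (by omega) hA
    have h2 := hlt (fun x hx => (hmem x).2 (Or.inr hx)) (by omega) hB
    omega
  by_cases hcut : ∀ v ∈ T, (((⊤ : G.Subgraph).induce (T : Set V)).deleteVerts {v}).Connected
  · exact adjPairCount_le_of_card_le_seven hplanar hC7 h2 (hsmall T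
      ⟨by simpa using one_lt_card_iff_nontrivial.1 h2, hconn, fun v hv => hcut v hv⟩) hmin
  · push Not at hcut
    obtain ⟨v, hv, hcut⟩ := hcut
    rw [deleteVerts_induce_top] at hcut
    have hc := card_erase_add_one hv
    obtain ⟨A, B, hA, hB, hcard, hmem, hsep⟩ := exists_separation (card_pos.1 (by omega)) hcut
    simp only [mem_erase] at hmem
    have hvA : v ∉ A := fun h => ((hmem v).2 (Or.inl h)).1 rfl
    have hvB : v ∉ B := fun h => ((hmem v).2 (Or.inr h)).1 rfl
    -- Both parts contain the cut vertex, so their sizes add up to `#T + 1`, which the constant 24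
    -- absorbs exactly.
    have hle : G.adjPairCount T ≤ G.adjPairCount (insert v A) + G.adjPairCount (insert v B) := by
      refine adjPairCount_le_add fun x hx y hy hxy => ?_
      simp only [mem_insert]
      rcases eq_or_ne x v with rfl | hxv
      · have := (hmem y).1 ⟨hxy.ne', hy⟩
        tauto
      rcases eq_or_ne y v with rfl | hyv
      · have := (hmem x).1 ⟨hxv, hx⟩
        tauto
      rcases (hmem x).1 ⟨hxv, hx⟩ with h3 | h3 <;> rcases (hmem y).1 ⟨hyv, hy⟩ with h4 | h4
      · exact Or.inl ⟨Or.inr h3, Or.inr h4⟩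
      · exact (hsep x h3 y h4 hxy).elim
      · exact (hsep y h4 x h3 hxy.symm).elim
      · exact Or.inr ⟨Or.inr h3, Or.inr h4⟩
    have hA0 := hA.card_pos
    have hB0 := hB.card_pos
    have hcA := card_insert_of_notMem hvA
    have hcB := card_insert_of_notMem hvB
    have h1 := hlt (A := insert v A) (fun x hx => by
      rcases mem_insert.1 hx with rfl | hx
      exacts [hv, ((hmem x).2 (Or.inl hx)).2]) (by omega) (insert_nonempty _ _)
    have h2 := hlt (A := insert v B) (fun x hx => by
      rcases mem_insert.1 hx with rfl | hx
      exacts [hv, ((hmem x).2 (Or.inr hx)).2]) (by omega) (insert_nonempty _ _)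
    omega

end SimpleGraph

theorem IsTwoConnected.exists_isBlock_ge {V : Type*} [Finite V] {G : SimpleGraph V}
    {H : G.Subgraph} (h : IsTwoConnected H) : ∃ B, IsBlock B ∧ H ≤ B := by
  obtain ⟨B, hle, hB⟩ := (Set.toFinite {K : G.Subgraph | IsTwoConnected K}).exists_le_maximal h
  exact ⟨B, hB, hle⟩

theorem corollary1 {V : Type*} [Fintype V] (hn : 2 ≤ Fintype.card V) (G : SimpleGraph V)
    (hplanar : IsPlanar G) (hC7 : (SimpleGraph.cycleGraph 7).Free G)
    (hblocks : ∀ B : G.Subgraph, IsBlock B → B.verts.ncard ≤ 7) :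
    (G.edgeSet.ncard : ℝ) ≤ 5 / 2 * (Fintype.card V : ℝ) - 18 / 7 := by
  classical
  have hmain := SimpleGraph.adjPairCount_le_of_planar hplanar hC7 (fun T hT => by
    obtain ⟨B, hB, hle⟩ := hT.exists_isBlock_ge
    have := Set.ncard_le_ncard (SimpleGraph.Subgraph.verts_mono hle) B.verts.toFinite
    rw [SimpleGraph.Subgraph.induce_verts, Set.ncard_coe_finset] at this
    exact this.trans (hblocks B hB)) Finset.univ (Finset.card_pos.1 (by rw [Finset.card_univ]; omega))
  have hpairs : G.adjPairCount Finset.univ = 2 * G.edgeSet.ncard := by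
    rw [Set.ncard_eq_toFinset_card', ← SimpleGraph.edgeFinset,
      ← SimpleGraph.sum_degrees_eq_twice_card_edges]
    simp only [SimpleGraph.adjPairCount, Finset.card_filter, Finset.sum_product]
    refine Finset.sum_congr rfl fun v _ => ?_
    rw [← Finset.card_filter, ← SimpleGraph.card_neighborFinset_eq_degree,
      SimpleGraph.neighborFinset_eq_filter]
  rw [hpairs, Finset.card_univ] at hmain
  have h1 : (10 : ℝ) * G.edgeSet.ncard + 24 ≤ 24 * Fintype.card V := by
    exact_mod_cast (by omega : 10 * G.edgeSet.ncard + 24 ≤ 24 * Fintype.card V)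
  have h2 : (2 : ℝ) ≤ Fintype.card V := by exact_mod_cast hn
  linarith
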